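/- Let $q$ be an odd prime power, let $H_0=SO_2(\mathbb F_q)=\left\{\begin{pmatrix} a&-b\\ b&a\end{pmatrix}: a,b\in\mathbb F_q,\ a^2+b^2=1\right\}$, and let $G_0=\mathbb F_q^2\rtimes H_0$ be the group of rigid motions of the plane, with the group law $(z_1,h_1)(z_2,h_2)=(z_1+h_1z_2,\,h_1h_2)$. For $g=(z,h)\in G_0$ write $\dot g=h$, and for $X,Y\subseteq G_0$ put $XY=\{xy: x\in X,\ y\in Y\}$ and $$\dot E(X,Y)=\#\{(g_1,g_2,h_1,h_2)\in X^2\times Y^2:\ \dot g_1\dot h_1=\dot g_2\dot h_2\}.$$ (1) There is an absolute constant $c>0$ such that for every odd prime power $q$ and all $X,Y\subseteq G_0$, $$|XY|\ \ge\ c\,\min\left\{\frac{q^2|X|^2|Y|^2}{\dot E(X,Y)},\ \frac{|X||Y|}{q^2}\right\},$$ where the right-hand side is read as $0$ if $X$ or $Y$ is empty. (2) The bound is sharp, for every odd prime power $q$, in the following sense. The group $H_0$ is cyclic; let $\gamma$ be a generator of it, let $|H_0|=kl$ with positive integers $k,l$, and let $$\mathcal X=\{(t,\gamma^{kj}):\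 t\in\mathbb F_q^2,\ 0\le j\le l-1\}.$$ Then $\mathcal X=\mathbb F_q^2\times\langle\gamma^k\rangle$ is a subgroup of $G_0$, with $|\mathcal X|=lq^2$, $\mathcal X\mathcal X=\mathcal X$ and $\dot E(\mathcal X,\mathcal X)=|\mathcal X|^3q^2$, and $$|\mathcal X\mathcal X|=\min\left\{\frac{q^2|\mathcal X|^4}{\dot E(\mathcal X,\mathcal X)},\ \frac{|\mathcal X|^2}{q^2}\right\}.$$ -/

import Mathlib

open scoped Pointwise

universe u

/-- The rotation group `SO₂(F)`: the matrices `A` with `A Aᵀ = 1` and `det A = 1`. -/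
abbrev SO2 (F : Type u) [Field F] : Type u :=
  Matrix.specialOrthogonalGroup (Fin 2) F

/-- Consistency check: over any field, `SO₂(F)` consists of the matrices
`[[a, -b], [b, a]]` with `a² + b² = 1`. -/
theorem mem_SO2_iff {F : Type u} [Field F] (M : Matrix (Fin 2) (Fin 2) F) :
    M ∈ Matrix.specialOrthogonalGroup (Fin 2) F ↔
      ∃ a b : F, a ^ 2 + b ^ 2 = 1 ∧ M = !![a, -b; b, a] := by
  rw [Matrix.mem_specialOrthogonalGroup_fin_two_iff]
  constructor
  · rintro ⟨h1, h2, h3⟩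
    refine ⟨M 0 0, M 1 0, ?_, ?_⟩
    · rw [← h3, h2]; ring
    · ext i j
      fin_cases i <;> fin_cases j <;> simp [h1, h2]
  · rintro ⟨a, b, h, rfl⟩
    refine ⟨?_, ?_, ?_⟩ <;> simp [← h]

/-- The action `φ_h(z) = h z` of `SO₂(F)` on the additive group `F²` (written multiplicatively
through the type tag `Multiplicative`, as the semidirect product of groups needs). -/
def rotationAction (F : Type u) [Field F] : SO2 F →* MulAut (Multiplicative (Fin 2 → F)) where
  toFun h :=
    { toFun := fun z => Multiplicative.ofAdd (Matrix.mulVec h.1 z.toAdd)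
      invFun := fun z => Multiplicative.ofAdd (Matrix.mulVec (h⁻¹).1 z.toAdd)
      left_inv := fun z => by
        have e : (h⁻¹).1 * h.1 = 1 := congrArg Subtype.val (inv_mul_cancel h)
        simp only [toAdd_ofAdd, Matrix.mulVec_mulVec, e, Matrix.one_mulVec, ofAdd_toAdd]
      right_inv := fun z => by
        have e : h.1 * (h⁻¹).1 = 1 := congrArg Subtype.val (mul_inv_cancel h)
        simp only [toAdd_ofAdd, Matrix.mulVec_mulVec, e, Matrix.one_mulVec, ofAdd_toAdd]
      map_mul' := fun z w => by
        simp only [toAdd_mul, Matrix.mulVec_add, ofAdd_add] }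
  map_one' := by
    ext z : 1
    exact congrArg Multiplicative.ofAdd (Matrix.one_mulVec z.toAdd)
  map_mul' g h := by
    ext z : 1
    exact congrArg Multiplicative.ofAdd (Matrix.mulVec_mulVec z.toAdd g.1 h.1).symm

/-- The group `G₀ = F² ⋊ SO₂(F)` of rigid motions. An element `g` has the translation part
`g.left` and the rotation part `g.right`. -/
abbrev RigidMotion (F : Type u) [Field F] : Type u :=
  Multiplicative (Fin 2 → F) ⋊[rotationAction F] SO2 F

/-- Consistency check: the group law is `(z₁, h₁)(z₂, h₂) = (z₁ + h₁ z₂, h₁ h₂)`. -/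
theorem RigidMotion.mk_mul_mk {F : Type u} [Field F] (z₁ z₂ : Fin 2 → F) (h₁ h₂ : SO2 F) :
    (⟨Multiplicative.ofAdd z₁, h₁⟩ * ⟨Multiplicative.ofAdd z₂, h₂⟩ : RigidMotion F) =
      ⟨Multiplicative.ofAdd (z₁ + Matrix.mulVec h₁.1 z₂), h₁ * h₂⟩ := rfl

/-- The number of quadruples `(g₁, g₂, h₁, h₂) ∈ X² × Y²` such that the rotation parts of
`g₁ h₁` and `g₂ h₂` are equal. -/
noncomputable def rotationEnergy {F : Type u} [Field F] (X Y : Set (RigidMotion F)) : ℕ :=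
  {p : RigidMotion F × RigidMotion F × RigidMotion F × RigidMotion F |
    p.1 ∈ X ∧ p.2.1 ∈ X ∧ p.2.2.1 ∈ Y ∧ p.2.2.2 ∈ Y ∧
      p.1.right * p.2.2.1.right = p.2.1.right * p.2.2.2.right}.ncard

/-- The quantity `min {q² |X|² |Y|² / Ė(X, Y), |X| |Y| / q²}` with `q = |F|`. -/
noncomputable def growthBound {F : Type u} [Field F] (X Y : Set (RigidMotion F)) : ℝ :=
  min ((Nat.card F : ℝ) ^ 2 * (X.ncard : ℝ) ^ 2 * (Y.ncard : ℝ) ^ 2 / (rotationEnergy X Y : ℝ))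
    ((X.ncard : ℝ) * (Y.ncard : ℝ) / (Nat.card F : ℝ) ^ 2)

/-- The set `{(t, (γ^k)^j) : t ∈ F², 0 ≤ j ≤ l - 1}` of rigid motions. -/
def powerMotions {F : Type u} [Field F] (γ : SO2 F) (k l : ℕ) : Set (RigidMotion F) :=
  {g | ∃ j : ℕ, j < l ∧ g.right = (γ ^ k) ^ j}

/-! Write `V = F²`, `|V| = q²`. Cauchy–Schwarz gives `|X|²|Y|² ≤ |XY| E(X, Y)`, so the
multiplicative energy must be bounded above. Fourier analysis in the translation variable,
separately over each rotation, writes `|V| E(X, Y)` as a sum over characters of `V`. The trivial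
character contributes exactly `Ė(X, Y)`. For `ψ ≠ 0`, the twists `ψ ∘ a` by distinct rotations `a`
are distinct, so Cauchy–Schwarz and Parseval bound the remaining terms by `|V|²|X||Y|`
(`card_mul_mulEnergy_le`). The larger of the two contributions decides which term of the minimum is
reached. For sharpness, the set is the preimage of a subgroup of rotations, where every quantity is
computed exactly. -/

open Finset in
/-- Parseval's identity for the image of a finite family in a finite abelian group. -/
theorem sum_addChar_norm_sq {V ι : Type*} [AddCommGroup V] [Fintype V] [DecidableEq V]
    (s : Finset ι) (f : ι → V) :
    ∑ ψ : AddChar V ℂ, ‖∑ i ∈ s, ψ (f i)‖ ^ 2 =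
      (Fintype.card V : ℝ) * #{p ∈ s ×ˢ s | f p.1 = f p.2} := by
  have key : ∀ ψ : AddChar V ℂ, ((‖∑ i ∈ s, ψ (f i)‖ ^ 2 : ℝ) : ℂ) =
      ∑ p ∈ s ×ˢ s, ψ (f p.1 - f p.2) := by
    intro ψ
    push_cast
    rw [← Complex.mul_conj', map_sum, sum_mul_sum, ← sum_product']
    refine sum_congr rfl fun p _ => ?_
    rw [← AddChar.map_neg_eq_conj, sub_eq_add_neg, AddChar.map_add_eq_mul]
  have : ((∑ ψ : AddChar V ℂ, ‖∑ i ∈ s, ψ (f i)‖ ^ 2 : ℝ) : ℂ) =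
      (((Fintype.card V : ℝ) * #{p ∈ s ×ˢ s | f p.1 = f p.2} : ℝ) : ℂ) := by
    rw [Complex.ofReal_sum, sum_congr rfl fun ψ _ => key ψ, sum_comm]
    simp_rw [AddChar.sum_apply_eq_ite, sub_eq_zero]
    rw [← sum_filter, sum_const]
    push_cast
    rw [nsmul_eq_mul, mul_comm]
  exact_mod_cast this

/-! ### Fourier analysis on a semidirect product -/

namespace SemidirectProduct

open Finset Multiplicative

variable {V H : Type*} [AddCommGroup V] [Group H] {φ : H →* MulAut (Multiplicative V)}

/-- The character `v ↦ ψ (a v)`. -/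
def twistChar (φ : H →* MulAut (Multiplicative V)) (ψ : AddChar V ℂ) (a : H) : AddChar V ℂ where
  toFun v := ψ (φ a (ofAdd v)).toAdd
  map_zero_eq_one' := by simp
  map_add_eq_mul' v w := by simp [AddChar.map_add_eq_mul]

theorem twistChar_apply (ψ : AddChar V ℂ) (a : H) (v : V) :
    twistChar φ ψ a v = ψ (φ a (ofAdd v)).toAdd := rfl

/-- If the action is free away from the identity, it is free on nontrivial characters. -/
theorem twistChar_injective [Finite V] (hφ : ∀ a : H, a ≠ 1 → MonoidHom.FixedPointFree (φ a))
    {ψ : AddChar V ℂ} (hψ : ψ ≠ 0) : Function.Injective (twistChar φ ψ) := by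
  intro a b hab
  by_contra hne
  refine hψ (DFunLike.ext _ _ fun v => ?_)
  have hfix : MonoidHom.FixedPointFree (φ (a * b⁻¹)) :=
    hφ _ fun h => hne (mul_inv_eq_one.mp h)
  -- By finiteness, every `v` has the form `z - (ab⁻¹)z`, and `ψ` is trivial on such differences.
  obtain ⟨z, hz⟩ := hfix.commutatorMap_surjective (ofAdd v)
  have h1 : ψ (φ (a * b⁻¹) z).toAdd = ψ z.toAdd := by
    have h := DFunLike.congr_fun hab (φ b⁻¹ z).toAdd
    rwa [twistChar_apply, twistChar_apply, ofAdd_toAdd, ← MulAut.mul_apply, ← MulAut.mul_apply,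
      ← map_mul, ← map_mul, mul_inv_cancel, map_one, MulAut.one_apply] at h
  have h2 : v = z.toAdd - (φ (a * b⁻¹) z).toAdd := (congrArg toAdd hz).symm
  rw [h2, AddChar.map_sub_eq_div, h1, AddChar.zero_apply]
  exact div_self (ψ.val_isUnit _).ne_zero

variable [DecidableEq H]

/-- The Fourier transform of the part of `X` over `a`. -/
noncomputable def fiberTransform (X : Finset (Multiplicative V ⋊[φ] H)) (a : H)
    (ψ : AddChar V ℂ) : ℂ :=
  ∑ g ∈ X with g.right = a, ψ g.left.toAdd

/-- Over a fixed rotation an element is determined by its translation, so only diagonal pairs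
collide in Parseval. -/
theorem sum_norm_sq_fiberTransform [Fintype V]
    (X : Finset (Multiplicative V ⋊[φ] H)) (a : H) :
    ∑ ψ : AddChar V ℂ, ‖fiberTransform X a ψ‖ ^ 2 =
      (Fintype.card V : ℝ) * #{g ∈ X | g.right = a} := by
  classical
  unfold fiberTransform
  rw [sum_addChar_norm_sq, ← diag_card {g ∈ X | g.right = a}]
  congr 3
  ext ⟨g, h⟩
  simp only [mem_filter, mem_product, mem_diag]
  constructor
  · rintro ⟨⟨⟨h1, h2⟩, h3, h4⟩, h5⟩
    exact ⟨⟨h1, h2⟩, SemidirectProduct.ext (toAdd.injective h5) (h2.trans h4.symm)⟩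
  · rintro ⟨h, rfl⟩
    exact ⟨⟨h, h⟩, rfl⟩

theorem sum_sum_norm_sq_fiberTransform [Fintype V] [Fintype H]
    (X : Finset (Multiplicative V ⋊[φ] H)) :
    ∑ a, ∑ ψ : AddChar V ℂ, ‖fiberTransform X a ψ‖ ^ 2 = (Fintype.card V : ℝ) * #X := by
  simp_rw [sum_norm_sq_fiberTransform, ← mul_sum]
  congr 1
  exact_mod_cast (card_eq_sum_card_fiberwise
    (f := fun g : Multiplicative V ⋊[φ] H => g.right) (t := univ) fun g _ => mem_coe.mpr (mem_univ _)).symm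

/-- The Fourier transform of the representation function of `X Y`, over `r`. -/
noncomputable def productTransform (X Y : Finset (Multiplicative V ⋊[φ] H)) (r : H)
    (ψ : AddChar V ℂ) : ℂ :=
  ∑ p ∈ X ×ˢ Y with p.1.right * p.2.right = r, ψ (p.1 * p.2).left.toAdd

/-- The translation part of `gh` is `g.left + g.right • h.left`, so `ψ` factors and its second
factor is twisted by `a = g.right`. -/
theorem productTransform_eq_sum [Fintype H] (X Y : Finset (Multiplicative V ⋊[φ] H)) (r : H)
    (ψ : AddChar V ℂ) :
    productTransform X Y r ψ =
      ∑ a, fiberTransform X a ψ * fiberTransform Y (a⁻¹ * r) (twistChar φ ψ a) := by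
  have : ∀ a, fiberTransform X a ψ * fiberTransform Y (a⁻¹ * r) (twistChar φ ψ a) =
      ∑ g ∈ X with g.right = a,
        ψ g.left.toAdd * fiberTransform Y (g.right⁻¹ * r) (twistChar φ ψ g.right) := by
    intro a
    rw [fiberTransform, sum_mul]
    refine sum_congr rfl fun g hg => ?_
    rw [(mem_filter.mp hg).2]
  simp_rw [this]
  rw [sum_fiberwise, productTransform, sum_filter, sum_product]
  refine sum_congr rfl fun g _ => ?_
  rw [fiberTransform, mul_sum, sum_filter]
  refine sum_congr rfl fun h _ => ?_
  simp only [eq_inv_mul_iff_mul_eq, mul_left, toAdd_mul, AddChar.map_add_eq_mul, twistChar_apply,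
    ofAdd_toAdd]

theorem sum_norm_sq_productTransform_le [Fintype V] [Fintype H]
    (hφ : ∀ a : H, a ≠ 1 → MonoidHom.FixedPointFree (φ a))
    (X Y : Finset (Multiplicative V ⋊[φ] H)) {ψ : AddChar V ℂ} (hψ : ψ ≠ 0) :
    ∑ r, ‖productTransform X Y r ψ‖ ^ 2 ≤
      (∑ a, ‖fiberTransform X a ψ‖ ^ 2) * ((Fintype.card V : ℝ) * #Y) := by
  classical
  have h1 : ∀ r, ‖productTransform X Y r ψ‖ ^ 2 ≤ (∑ a, ‖fiberTransform X a ψ‖ ^ 2) *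
      ∑ a, ‖fiberTransform Y (a⁻¹ * r) (twistChar φ ψ a)‖ ^ 2 := by
    intro r
    rw [productTransform_eq_sum]
    refine le_trans ?_ (sum_mul_sq_le_sq_mul_sq _ _ _)
    gcongr
    refine (norm_sum_le _ _).trans_eq ?_
    simp_rw [norm_mul]
  refine (sum_le_sum fun r _ => h1 r).trans ?_
  rw [← mul_sum, sum_comm]
  gcongr
  have h2 : ∀ a, ∑ r, ‖fiberTransform Y (a⁻¹ * r) (twistChar φ ψ a)‖ ^ 2 =
      ∑ b, ‖fiberTransform Y b (twistChar φ ψ a)‖ ^ 2 := fun a =>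
    Equiv.sum_comp (Equiv.mulLeft a⁻¹) fun b => ‖fiberTransform Y b (twistChar φ ψ a)‖ ^ 2
  simp_rw [h2]
  rw [sum_comm, ← sum_sum_norm_sq_fiberTransform Y]
  refine sum_le_sum fun b _ => ?_
  -- Distinct `a` give distinct characters, so the sum over `a` is part of the Parseval sum over the
  -- whole dual.
  rw [← sum_image (s := univ) (g := twistChar φ ψ)
    (f := fun χ => ‖fiberTransform Y b χ‖ ^ 2) (twistChar_injective hφ hψ).injOn]
  exact sum_le_sum_of_subset_of_nonneg (subset_univ _) fun _ _ _ => by positivity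

open scoped Combinatorics.Additive in
theorem card_mul_mulEnergy_eq [Fintype V] [Fintype H] [DecidableEq V]
    [DecidableEq (Multiplicative V ⋊[φ] H)]
    (X Y : Finset (Multiplicative V ⋊[φ] H)) :
    (Fintype.card V : ℝ) * Eₘ[X, Y] =
      ∑ ψ : AddChar V ℂ, ∑ r, ‖productTransform X Y r ψ‖ ^ 2 := by
  rw [sum_comm]
  simp_rw [productTransform, sum_addChar_norm_sq, ← mul_sum]
  congr 1
  have : Eₘ[X, Y] = #{p ∈ (X ×ˢ Y) ×ˢ (X ×ˢ Y) | p.1.1 * p.1.2 = p.2.1 * p.2.2} := by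
    rw [mulEnergy]
    refine card_nbij' (fun p => ((p.1.1, p.2.1), (p.1.2, p.2.2)))
      (fun p => ((p.1.1, p.2.1), (p.1.2, p.2.2))) ?_ ?_ ?_ ?_
    · intro p hp
      simp only [coe_filter, mem_product, Set.mem_ofPred_eq] at hp ⊢
      tauto
    · intro p hp
      simp only [coe_filter, mem_product, Set.mem_ofPred_eq] at hp ⊢
      tauto
    · intro p _; rfl
    · intro p _; rfl
  rw [this, card_eq_sum_card_fiberwise (f := fun p => p.1.1.right * p.1.2.right)
    (t := univ) fun _ _ => mem_coe.mpr (mem_univ _)]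
  push_cast
  refine sum_congr rfl fun r _ => ?_
  congr 2
  ext ⟨⟨g, h⟩, g', h'⟩
  simp only [mem_filter, mem_product]
  constructor
  · rintro ⟨⟨⟨⟨h1, h2⟩, h3, h4⟩, h5⟩, h6⟩
    refine ⟨⟨⟨⟨h1, h2⟩, h6⟩, ⟨h3, h4⟩, ?_⟩, by rw [h5]⟩
    rw [← h6]
    exact (congrArg right h5).symm
  · rintro ⟨⟨⟨⟨h1, h2⟩, h6⟩, ⟨h3, h4⟩, h7⟩, h5⟩
    exact ⟨⟨⟨⟨h1, h2⟩, h3, h4⟩,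
      SemidirectProduct.ext (toAdd.injective h5) (h6.trans h7.symm)⟩, h6⟩

/-- At the trivial character (`0` additively) the transform merely counts pairs, leaving the
rotation energy. -/
theorem sum_norm_sq_productTransform_zero [Fintype H] (X Y : Finset (Multiplicative V ⋊[φ] H)) :
    ∑ r, ‖productTransform X Y r 0‖ ^ 2 =
      #{p ∈ (X ×ˢ Y) ×ˢ (X ×ˢ Y) | p.1.1.right * p.1.2.right = p.2.1.right * p.2.2.right} := by
  rw [card_eq_sum_card_fiberwise (f := fun p => p.1.1.right * p.1.2.right)
    (t := univ) fun _ _ => mem_coe.mpr (mem_univ _)]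
  push_cast
  refine sum_congr rfl fun r _ => ?_
  simp only [productTransform, AddChar.zero_apply, sum_const, nsmul_eq_mul, mul_one,
    Complex.norm_natCast]
  rw [sq, ← Nat.cast_mul, ← card_product]
  congr 2
  ext ⟨⟨g, h⟩, g', h'⟩
  simp only [mem_filter, mem_product]
  constructor
  · rintro ⟨⟨⟨h1, h2⟩, h6⟩, ⟨h3, h4⟩, h7⟩
    exact ⟨⟨⟨⟨h1, h2⟩, h3, h4⟩, h6.trans h7.symm⟩, h6⟩
  · rintro ⟨⟨⟨⟨h1, h2⟩, h3, h4⟩, h5⟩, h6⟩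
    exact ⟨⟨⟨h1, h2⟩, h6⟩, ⟨h3, h4⟩, h5 ▸ h6⟩

open scoped Combinatorics.Additive in
/-- The energy bound `|V| E(X, Y) ≤ Ė(X, Y) + |V|² |X| |Y|`. -/
theorem card_mul_mulEnergy_le [Fintype V] [Fintype H] [DecidableEq (Multiplicative V ⋊[φ] H)]
    (hφ : ∀ a : H, a ≠ 1 → MonoidHom.FixedPointFree (φ a))
    (X Y : Finset (Multiplicative V ⋊[φ] H)) :
    (Fintype.card V : ℝ) * Eₘ[X, Y] ≤
      #{p ∈ (X ×ˢ Y) ×ˢ (X ×ˢ Y) | p.1.1.right * p.1.2.right = p.2.1.right * p.2.2.right} +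
        (Fintype.card V : ℝ) ^ 2 * #X * #Y := by
  classical
  rw [card_mul_mulEnergy_eq, ← add_sum_erase _ _ (mem_univ (0 : AddChar V ℂ)),
    sum_norm_sq_productTransform_zero]
  gcongr
  calc _ ≤ ∑ ψ ∈ univ.erase (0 : AddChar V ℂ),
        (∑ a, ‖fiberTransform X a ψ‖ ^ 2) * ((Fintype.card V : ℝ) * #Y) :=
        sum_le_sum fun ψ hψ => sum_norm_sq_productTransform_le hφ X Y (ne_of_mem_erase hψ)
    _ ≤ ∑ ψ : AddChar V ℂ,
        (∑ a, ‖fiberTransform X a ψ‖ ^ 2) * ((Fintype.card V : ℝ) * #Y) :=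
        sum_le_sum_of_subset_of_nonneg (erase_subset _ _) fun _ _ _ => by positivity
    _ = _ := by
        rw [← sum_mul, sum_comm, sum_sum_norm_sq_fiberTransform]
        ring

end SemidirectProduct
-- Rotations: absence of fixed vectors, and cyclicity
section SpecialOrthogonal

variable {F : Type u} [Field F]

theorem two_ne_zero_of_odd_card [Finite F] (hF : Odd (Nat.card F)) : (2 : F) ≠ 0 := by
  have := Fintype.ofFinite F
  rw [Nat.card_eq_fintype_card] at hF
  intro h
  have h1 : addOrderOf (1 : F) = 2 := by
    refine addOrderOf_eq_prime ?_ one_ne_zero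
    rw [two_nsmul, one_add_one_eq_two, h]
  have h2 : 2 ∣ Fintype.card F := h1 ▸ addOrderOf_dvd_card
  exact Nat.not_even_iff_odd.mpr hF (even_iff_two_dvd.mpr h2)

theorem SO2.exists_eq (h : SO2 F) :
    ∃ a b : F, a ^ 2 + b ^ 2 = 1 ∧ (h : Matrix (Fin 2) (Fin 2) F) = !![a, -b; b, a] :=
  (mem_SO2_iff h.1).mp h.2

theorem SO2.eq_one_of_apply_eq_one {h : SO2 F} (h00 : h.1 0 0 = 1) : h = 1 := by
  obtain ⟨a, b, hab, hM⟩ := SO2.exists_eq h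
  have ha : a = 1 := by simpa [hM] using h00
  have hb : b = 0 := by
    rw [ha] at hab
    simpa using hab
  refine Subtype.ext ?_
  rw [hM, ha, hb, neg_zero]
  exact Matrix.one_fin_two.symm

theorem rotationAction_fixedPointFree (h2 : (2 : F) ≠ 0) (h : SO2 F) (hne : h ≠ 1) :
    MonoidHom.FixedPointFree (rotationAction F h) := by
  intro z hz
  obtain ⟨a, b, hab, hM⟩ := SO2.exists_eq h
  have ha : a ≠ 1 := fun ha => hne (SO2.eq_one_of_apply_eq_one (by simp [hM, ha]))
  have hz' : Matrix.mulVec h.1 z.toAdd = z.toAdd := congrArg Multiplicative.toAdd hz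
  rw [hM] at hz'
  generalize hw : z.toAdd = w at hz'
  have e0 : a * w 0 + -b * w 1 = w 0 := by
    simpa [Matrix.mulVec, dotProduct, Fin.sum_univ_two] using congrFun hz' 0
  have e1 : b * w 0 + a * w 1 = w 1 := by
    simpa [Matrix.mulVec, dotProduct, Fin.sum_univ_two] using congrFun hz' 1
  -- This is `det (h - 1) = (a - 1)² + b²`; the combinations below multiply by the adjugate of `h -
  -- 1`.
  have hd : 2 * (1 - a) ≠ 0 := mul_ne_zero h2 (sub_ne_zero.mpr ha.symm)
  have w0 : w 0 = 0 := by
    refine (mul_eq_zero.mp (?_ : 2 * (1 - a) * w 0 = 0)).resolve_left hd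
    linear_combination (a - 1) * e0 + b * e1 - w 0 * hab
  have w1 : w 1 = 0 := by
    refine (mul_eq_zero.mp (?_ : 2 * (1 - a) * w 1 = 0)).resolve_left hd
    linear_combination (a - 1) * e1 - b * e0 - w 1 * hab
  refine Multiplicative.toAdd.injective ?_
  rw [hw]
  ext i
  fin_cases i
  · exact w0
  · exact w1

/-- The embedding `[[a, -b], [b, a]] ↦ a + i b`, for a square root `i` of `-1` in an extension. -/
def SO2.toExtension {K : Type*} [Field K] [Algebra F K] (i : K) (hi : i ^ 2 = -1) :
    SO2 F →* K where
  toFun h := algebraMap F K (h.1 0 0) + i * algebraMap F K (h.1 1 0)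
  map_one' := by simp
  map_mul' g h := by
    obtain ⟨a, b, -, hg⟩ := SO2.exists_eq g
    obtain ⟨c, d, -, hh⟩ := SO2.exists_eq h
    have : (g * h).1 = g.1 * h.1 := rfl
    rw [this, hg, hh]
    simp [Matrix.mul_apply, Fin.sum_univ_two]
    linear_combination (-(algebraMap F K b * algebraMap F K d)) * hi

theorem SO2.toExtension_injective {K : Type*} [Field K] [Algebra F K] (i : K) (hi : i ^ 2 = -1)
    (h2 : (2 : F) ≠ 0) : Function.Injective (SO2.toExtension (F := F) i hi) := by
  rw [injective_iff_map_eq_one]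
  intro h hh
  obtain ⟨a, b, hab, hM⟩ := SO2.exists_eq h
  have h1 : algebraMap F K a + i * algebraMap F K b = 1 := by
    have : algebraMap F K (h.1 0 0) + i * algebraMap F K (h.1 1 0) = 1 := hh
    simpa [hM] using this
  have hab' : algebraMap F K a ^ 2 + algebraMap F K b ^ 2 = 1 := by
    rw [← map_pow, ← map_pow, ← map_add, hab, map_one]
  -- The inverse of `a + ib` is `a - ib`, so both equal `1`; adding them gives `2a = 2`.
  have h3 : algebraMap F K (2 * a) = algebraMap F K 2 := by
    rw [map_mul, map_ofNat]
    linear_combination hab' + (1 - (algebraMap F K a - i * algebraMap F K b)) * h1 +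
      (-algebraMap F K b ^ 2) * hi
  have ha : a = 1 := by
    refine mul_left_cancel₀ h2 ?_
    rw [(algebraMap F K).injective h3, mul_one]
  exact SO2.eq_one_of_apply_eq_one (by simp [hM, ha])

/-- A finite group embedded in the multiplicative monoid of a field is cyclic; passing to the
closure supplies `i` whether or not `-1` is a square in `F`. -/
theorem SO2.isCyclic [Finite F] (h2 : (2 : F) ≠ 0) : IsCyclic (SO2 F) := by
  obtain ⟨i, hi⟩ := IsAlgClosed.exists_pow_nat_eq (-1 : AlgebraicClosure F) two_pos
  exact isCyclic_of_injective_ringHom _ (SO2.toExtension_injective i hi h2)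

end SpecialOrthogonal

theorem card_plane (F : Type*) : Nat.card (Fin 2 → F) = Nat.card F ^ 2 := by
  rw [Nat.card_fun, Nat.card_eq_fintype_card (α := Fin 2), Fintype.card_fin]

/-! ### The lower bound for rigid motions -/

section RigidMotion

variable {F : Type u} [Field F]

instance [Finite F] : Finite (RigidMotion F) :=
  Finite.of_equiv _ SemidirectProduct.equivProd.symm

open Finset in
theorem rotationEnergy_coe [DecidableEq (SO2 F)] (X Y : Finset (RigidMotion F)) :
    rotationEnergy (X : Set (RigidMotion F)) Y =
      #{p ∈ (X ×ˢ Y) ×ˢ (X ×ˢ Y) | p.1.1.right * p.1.2.right = p.2.1.right * p.2.2.right} := by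
  rw [rotationEnergy, ← Set.ncard_coe_finset]
  refine Set.ncard_congr (fun p _ => ((p.1, p.2.2.1), (p.2.1, p.2.2.2))) ?_ ?_ ?_
  · rintro ⟨g, g', h, h'⟩ hp
    simp only [mem_coe, Set.mem_ofPred_eq, mem_filter, mem_product] at hp ⊢
    tauto
  · rintro ⟨g, g', h, h'⟩ ⟨k, k', l, l'⟩ - - hp
    simp only [Prod.mk.injEq] at hp ⊢
    tauto
  · rintro ⟨⟨g, h⟩, g', h'⟩ hp
    refine ⟨(g, g', h, h'), ?_, rfl⟩
    simp only [mem_coe, Set.mem_ofPred_eq, mem_filter, mem_product] at hp ⊢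
    tauto

/-- Here `A = |X|`, `B = |Y|`, `P = q²`, `D = Ė`, `N = |XY|`, and `E` is the energy. The factor
`1/2` comes from replacing `D + P²AB` by twice its larger summand. -/
theorem half_mul_min_le {A B P D N E : ℝ} (hA : 0 < A) (hB : 0 < B) (hN : 0 ≤ N)
    (hP : 0 < P) (hE : P * E ≤ D + P ^ 2 * A * B) (hNE : A ^ 2 * B ^ 2 ≤ N * E) :
    1 / 2 * min (P * A ^ 2 * B ^ 2 / D) (A * B / P) ≤ N := by
  have h1 : P * (A ^ 2 * B ^ 2) ≤ N * (D + P ^ 2 * A * B) :=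
    calc P * (A ^ 2 * B ^ 2) ≤ P * (N * E) := by gcongr
      _ = N * (P * E) := by ring
      _ ≤ _ := by gcongr
  rcases le_total D (P ^ 2 * A * B) with h | h
  · have h2 : A * B / P ≤ 2 * N := by
      rw [div_le_iff₀ hP]
      have h3 : P * (A * B) * (A * B) ≤ P * (A * B) * (2 * N * P) :=
        calc _ = P * (A ^ 2 * B ^ 2) := by ring
          _ ≤ N * (D + P ^ 2 * A * B) := h1
          _ ≤ N * (P ^ 2 * A * B + P ^ 2 * A * B) := by gcongr
          _ = _ := by ring
      exact le_of_mul_le_mul_left h3 (by positivity)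
    linarith [min_le_right (P * A ^ 2 * B ^ 2 / D) (A * B / P)]
  · have hD' : 0 < D := lt_of_lt_of_le (by positivity) h
    have h2 : P * A ^ 2 * B ^ 2 / D ≤ 2 * N := by
      rw [div_le_iff₀ hD']
      calc _ = P * (A ^ 2 * B ^ 2) := by ring
        _ ≤ N * (D + P ^ 2 * A * B) := h1
        _ ≤ N * (D + D) := by gcongr
        _ = _ := by ring
    linarith [min_le_left (P * A ^ 2 * B ^ 2 / D) (A * B / P)]

theorem half_mul_growthBound_le [Finite F] (h2 : (2 : F) ≠ 0) (X Y : Set (RigidMotion F)) :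
    1 / 2 * growthBound X Y ≤ ((X * Y).ncard : ℝ) := by
  classical
  have := Fintype.ofFinite F
  have := Fintype.ofFinite (SO2 F)
  rcases X.eq_empty_or_nonempty with rfl | hX
  · simp [growthBound]
  rcases Y.eq_empty_or_nonempty with rfl | hY
  · simp [growthBound]
  lift X to Finset (RigidMotion F) using X.toFinite
  lift Y to Finset (RigidMotion F) using Y.toFinite
  have hV : (Fintype.card (Fin 2 → F) : ℝ) = (Nat.card F : ℝ) ^ 2 := by
    rw [Fintype.card_fun, Fintype.card_fin, Nat.card_eq_fintype_card]
    push_cast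
    rfl
  have hE := SemidirectProduct.card_mul_mulEnergy_le (rotationAction_fixedPointFree h2) X Y
  rw [hV, ← rotationEnergy_coe] at hE
  rw [growthBound, ← Finset.coe_mul]
  simp only [Set.ncard_coe_finset]
  have hq : (0 : ℝ) < Nat.card F := by exact_mod_cast Nat.card_pos
  refine half_mul_min_le ?_ ?_ (Nat.cast_nonneg _) (by positivity) hE ?_
  · exact_mod_cast Finset.card_pos.mpr (Finset.coe_nonempty.mp hX)
  · exact_mod_cast Finset.card_pos.mpr (Finset.coe_nonempty.mp hY)
  · exact_mod_cast Finset.le_card_mul_mul_mulEnergy X Y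

/-! ### Sharpness: preimages of rotation subgroups -/

/-- The rigid motions with rotation part in `K`. -/
def motionsOver (K : Subgroup (SO2 F)) : Subgroup (RigidMotion F) :=
  K.comap SemidirectProduct.rightHom

theorem mem_motionsOver {K : Subgroup (SO2 F)} {g : RigidMotion F} :
    g ∈ motionsOver K ↔ g.right ∈ K := Iff.rfl

/-- A rigid motion over `K` is a translation part and an element of `K`. -/
def motionsOverEquiv (K : Subgroup (SO2 F)) : motionsOver K ≃ (Fin 2 → F) × K where
  toFun g := (g.1.left.toAdd, ⟨g.1.right, g.2⟩)
  invFun p := ⟨⟨Multiplicative.ofAdd p.1, p.2.1⟩, p.2.2⟩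
  left_inv _ := rfl
  right_inv _ := rfl

theorem ncard_motionsOver [Finite F] (K : Subgroup (SO2 F)) :
    (motionsOver K : Set (RigidMotion F)).ncard = Nat.card K * Nat.card F ^ 2 := by
  rw [← Nat.card_coe_set_eq]
  refine (Nat.card_congr (motionsOverEquiv K)).trans ?_
  rw [Nat.card_prod, card_plane F, mul_comm]

/-- Three entries of a quadruple are free; the rotation of the fourth is then forced and lies in
`K`, while its translation is arbitrary. -/
theorem rotationEnergy_motionsOver [Finite F] (K : Subgroup (SO2 F)) :
    rotationEnergy (motionsOver K : Set (RigidMotion F)) (motionsOver K) =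
      (motionsOver K : Set (RigidMotion F)).ncard ^ 3 * Nat.card F ^ 2 := by
  let e : {p : RigidMotion F × RigidMotion F × RigidMotion F × RigidMotion F |
      p.1 ∈ (motionsOver K : Set (RigidMotion F)) ∧ p.2.1 ∈ (motionsOver K : Set (RigidMotion F)) ∧
      p.2.2.1 ∈ (motionsOver K : Set (RigidMotion F)) ∧
      p.2.2.2 ∈ (motionsOver K : Set (RigidMotion F)) ∧
      p.1.right * p.2.2.1.right = p.2.1.right * p.2.2.2.right} ≃
      motionsOver K × motionsOver K × motionsOver K × (Fin 2 → F) :=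
    { toFun := fun p => (⟨p.1.1, p.2.1⟩, ⟨p.1.2.1, p.2.2.1⟩, ⟨p.1.2.2.1, p.2.2.2.1⟩,
        p.1.2.2.2.left.toAdd)
      invFun := fun p => ⟨(p.1.1, p.2.1.1, p.2.2.1.1,
          ⟨Multiplicative.ofAdd p.2.2.2, p.2.1.1.right⁻¹ * (p.1.1.right * p.2.2.1.1.right)⟩),
        p.1.2, p.2.1.2, p.2.2.1.2,
        K.mul_mem (K.inv_mem p.2.1.2) (K.mul_mem p.1.2 p.2.2.1.2), by simp⟩
      left_inv := by
        rintro ⟨⟨g, g', h, h'⟩, hg, hg', hh, hh', heq⟩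
        refine Subtype.ext (Prod.ext rfl (Prod.ext rfl (Prod.ext rfl
          (SemidirectProduct.ext rfl ?_))))
        exact inv_mul_eq_iff_eq_mul.mpr heq
      right_inv := fun _ => rfl }
  rw [rotationEnergy, ← Nat.card_coe_set_eq, Nat.card_congr e, Nat.card_prod, Nat.card_prod,
    Nat.card_prod, card_plane F, ← Nat.card_coe_set_eq]
  change Nat.card (motionsOver K) * _ = Nat.card (motionsOver K) ^ 3 * _
  ring

/-- The first term of the minimum equals the size of the set; the second is `|K|` times as large. -/
theorem growthBound_motionsOver [Finite F] (K : Subgroup (SO2 F)) :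
    growthBound (motionsOver K : Set (RigidMotion F)) (motionsOver K) =
      (motionsOver K : Set (RigidMotion F)).ncard := by
  have hq : (0 : ℝ) < Nat.card F := by exact_mod_cast Nat.card_pos
  have hK : (1 : ℝ) ≤ Nat.card K := by exact_mod_cast Nat.card_pos
  rw [growthBound, rotationEnergy_motionsOver, ncard_motionsOver]
  push_cast
  rw [min_eq_left]
  · field_simp
  · rw [div_le_div_iff₀ (by positivity) (by positivity)]
    have : (Nat.card K : ℝ) ^ 4 * (Nat.card F : ℝ) ^ 12 * 1 ≤
        (Nat.card K : ℝ) ^ 4 * (Nat.card F : ℝ) ^ 12 * Nat.card K := by gcongr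
    linarith

theorem powerMotions_eq_motionsOver [Finite F] {γ : SO2 F} {k l : ℕ} (hl : orderOf (γ ^ k) = l) :
    powerMotions γ k l = motionsOver (Subgroup.zpowers (γ ^ k)) := by
  classical
  ext g
  rw [SetLike.mem_coe, mem_motionsOver, mem_zpowers_iff_mem_range_orderOf, hl]
  simp [powerMotions, eq_comm]

end RigidMotion

theorem theorem7 :
    -- the lower bound, with an absolute constant
    (∃ c : ℝ, 0 < c ∧
      ∀ (F : Type u) [Field F] [Finite F], Odd (Nat.card F) →
        ∀ X Y : Set (RigidMotion F), c * growthBound X Y ≤ ((X * Y).ncard : ℝ)) ∧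
    -- sharpness
    (∀ (F : Type u) [Field F] [Finite F], Odd (Nat.card F) →
      IsCyclic (SO2 F) ∧
      ∀ γ : SO2 F, (∀ h : SO2 F, h ∈ Subgroup.zpowers γ) →
        ∀ k l : ℕ, k * l = Nat.card (SO2 F) →
          powerMotions γ k l =
              ((Subgroup.zpowers (γ ^ k)).comap SemidirectProduct.rightHom :
                Subgroup (RigidMotion F)) ∧
          (powerMotions γ k l).ncard = l * Nat.card F ^ 2 ∧
          powerMotions γ k l * powerMotions γ k l = powerMotions γ k l ∧
          rotationEnergy (powerMotions γ k l) (powerMotions γ k l) =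
            (powerMotions γ k l).ncard ^ 3 * Nat.card F ^ 2 ∧
          ((powerMotions γ k l * powerMotions γ k l).ncard : ℝ) =
            growthBound (powerMotions γ k l) (powerMotions γ k l)) := by
  refine ⟨⟨1 / 2, by norm_num, fun F _ _ hF X Y =>
    half_mul_growthBound_le (two_ne_zero_of_odd_card hF) X Y⟩, fun F _ _ hF =>
    ⟨SO2.isCyclic (two_ne_zero_of_odd_card hF), fun γ hγ k l hkl => ?_⟩⟩
  have hγ' : orderOf γ = Nat.card (SO2 F) := orderOf_eq_card_of_forall_mem_zpowers hγ
  have hk : k ≠ 0 := by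
    rintro rfl
    exact Nat.card_pos.ne (by simpa using hkl)
  -- With order exactly `l`, the exponents `j < l` exhaust the subgroup generated by `γ ^ k`.
  have hl : orderOf (γ ^ k) = l := by
    rw [orderOf_pow_of_dvd hk (hγ' ▸ hkl ▸ Dvd.intro l rfl), hγ', ← hkl]
    exact Nat.mul_div_cancel_left l (Nat.pos_of_ne_zero hk)
  have hmul : powerMotions γ k l * powerMotions γ k l = powerMotions γ k l := by
    rw [powerMotions_eq_motionsOver hl]
    exact coe_mul_coe _
  rw [hmul]
  rw [powerMotions_eq_motionsOver hl, growthBound_motionsOver, rotationEnergy_motionsOver,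
    ncard_motionsOver, Nat.card_zpowers, hl]
  exact ⟨rfl, rfl, rfl, rfl, rfl⟩
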